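/- Let $S$ be a countably infinite cancellative semigroup. For finite sets $K,F\subseteq S$ and $\epsilon>0$, call $F$ \emph{$(K,\epsilon)$-invariant} if $|kF\triangle F|<\epsilon|F|$ for all $k\in K$. A \emph{left F\o lner sequence} is a sequence $\mathcal F=(F_n)_{n\ge 1}$ of nonempty finite subsets of $S$ with $\lim_{n\to\infty}|sF_n\triangle F_n|/|F_n|=0$ for every $s\in S$. Assume that $S$ is \emph{left amenable}, that is, $S$ admits a left F\o lner sequence. For $B\subseteq S$ let $$d^*(B)=\sup\Big\{\limsup_{n\to\infty}\frac{|B\cap F_n|}{|F_n|}\ :\ (F_n)_{n\ge1}\text{ is a left F\o lner sequence in }S\Big\}$$ be the upper Banach density of $B$. Let $\delta\in(0,1]$, and let $\mathcal A$ be a collection of finite subsets of $S$ that is right translation invariant, i.e. $As=\{as : a\in A\}\in\mathcal A$ for all $A\in\mathcal A$ and $s\in S$. Then the following are equivalent: (i) For every $B\subseteq S$ with $d^*(B)\ge\delta$ there is $A\in\mathcal A$ with $A\subseteq B$. (ii) There are a finite set $K\subseteq S$ and $\epsilon>0$ such that for every $(K,\epsilon)$-invariant finite set $F\subseteq S$ and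 every $B\subseteq F$ with $|B|\ge\delta|F|$ there is $A\in\mathcal A$ with $A\subseteq B$. (iii) There is a finite set $H\subseteq S$ such that for every $B\subseteq H$ with $|B|\ge\delta|H|$ there is $A\in\mathcal A$ with $A\subseteq B$. (iv) There are a nonempty finite set $H\subseteq S$ and $\epsilon>0$ such that for every $B\subseteq H$ with $|B|>(\delta-\epsilon)|H|$ there is $A\in\mathcal A$ with $A\subseteq B$. (v) There is $\epsilon>0$ such that for every $B\subseteq S$ with $d^*(B)>\delta-\epsilon$ there is $A\in\mathcal A$ with $A\subseteq B$. -/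

import Mathlib

open Filter Topology

namespace DensityRamsey

/-- The upper density of `A` along `F`: the limsup of `|A ∩ F n| / |F n|`. -/
noncomputable def upperDensity {S : Type*} (F : ℕ → Finset S) (A : Set S) : ℝ :=
  limsup (fun n => ((A ∩ (F n : Set S)).ncard : ℝ) / ((F n).card : ℝ)) atTop

variable {S : Type*} [Semigroup S] [DecidableEq S]

/-- The left translate `s F = {s f | f ∈ F}` of a finite set. -/
def leftTranslate (s : S) (F : Finset S) : Finset S := F.image (fun f => s * f)

/-- The right translate `A s = {a s | a ∈ A}` of a finite set. -/
def rightTranslate (A : Finset S) (s : S) : Finset S := A.image (fun a => a * s)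

/-- A finite set `F` is `(K, ε)`-invariant if `|kF ∆ F| < ε |F|` for all `k ∈ K`. -/
def IsInvariant (K : Finset S) (ε : ℝ) (F : Finset S) : Prop :=
  ∀ k ∈ K, ((symmDiff (leftTranslate k F) F).card : ℝ) < ε * (F.card : ℝ)

/-- A left Følner sequence: nonempty finite sets `F n` with `|s F n ∆ F n| / |F n| → 0` for
every `s`. Nonemptiness is what makes the quotients meaningful. -/
def IsLeftFolner (F : ℕ → Finset S) : Prop :=
  (∀ n, (F n).Nonempty) ∧
    ∀ s : S, Tendsto
      (fun n => ((symmDiff (leftTranslate s (F n)) (F n)).card : ℝ) / ((F n).card : ℝ))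
      atTop (𝓝 0)

/-- A (cancellative) semigroup is left amenable if it admits a left Følner sequence. -/
def IsLeftAmenable (S : Type*) [Semigroup S] [DecidableEq S] : Prop :=
  ∃ F : ℕ → Finset S, IsLeftFolner F

/-- The upper Banach density `d*(A)`: the supremum of the upper densities of `A` along all
left Følner sequences. -/
noncomputable def upperBanachDensity (A : Set S) : ℝ :=
  sSup {d : ℝ | ∃ F : ℕ → Finset S, IsLeftFolner F ∧ d = upperDensity F A}

/-- A family of finite sets is right translation invariant if it contains `A s` whenever it
contains `A`. -/
def IsRightTranslationInvariant (𝒜 : Set (Finset S)) : Prop :=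
  ∀ A ∈ 𝒜, ∀ s : S, rightTranslate A s ∈ 𝒜

end DensityRamsey

open MeasureTheory

namespace DensityRamsey

open scoped Finset ENNReal

section Density

variable {S : Type*}

/-! The deep step is (i) ⇒ (ii). If (ii) fails, its counterexamples form a Følner sequence `F n`
with dense subsets `B n` avoiding `𝒜`. For `f` uniform in `F n`, the random set `{s | s * f ∈ B n}`
still avoids `𝒜`, by right invariance, and contains each fixed `s` with probability at least `δ -
o(1)`, by left invariance of `F n`. A limit of these laws lives on the compact space `avoiders 𝒜`,
and reverse Fatou picks out one avoiding set of upper density at least `δ` along `F`, against (i).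
The gain of `ε` in (iv) is free because cardinalities are integers, and (iv) ⇒ (v) is double
counting: a dense set meets some right translate of `H` densely. -/

lemma ncard_inter_eq_card_filter (B : Set S) (F : Finset S) [DecidablePred (· ∈ B)] :
    (B ∩ (F : Set S)).ncard = #{x ∈ F | x ∈ B} := by
  rw [← Set.ncard_coe_finset]
  congr 1
  ext x
  simp [and_comm]

lemma ncard_inter_div_card_nonneg (B : Set S) (F : Finset S) :
    0 ≤ ((B ∩ (F : Set S)).ncard : ℝ) / (F.card : ℝ) := by positivity

lemma ncard_inter_div_card_le_one (B : Set S) (F : Finset S) :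
    ((B ∩ (F : Set S)).ncard : ℝ) / (F.card : ℝ) ≤ 1 := by
  classical
  refine div_le_one_of_le₀ ?_ (by positivity)
  rw [ncard_inter_eq_card_filter]
  exact_mod_cast Finset.card_filter_le _ _

lemma isBoundedUnder_density (F : ℕ → Finset S) (B : Set S) :
    IsBoundedUnder (· ≤ ·) atTop
      fun n => ((B ∩ (F n : Set S)).ncard : ℝ) / ((F n).card : ℝ) :=
  isBoundedUnder_of ⟨1, fun n => ncard_inter_div_card_le_one B (F n)⟩

lemma isCoboundedUnder_density (F : ℕ → Finset S) (B : Set S) :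
    IsCoboundedUnder (· ≤ ·) atTop
      fun n => ((B ∩ (F n : Set S)).ncard : ℝ) / ((F n).card : ℝ) :=
  IsBoundedUnder.isCoboundedUnder_le
    (isBoundedUnder_of ⟨0, fun n => ncard_inter_div_card_nonneg B (F n)⟩)

lemma upperDensity_le_one (F : ℕ → Finset S) (B : Set S) : upperDensity F B ≤ 1 :=
  limsup_le_of_le (isCoboundedUnder_density F B)
    (Eventually.of_forall fun n => ncard_inter_div_card_le_one B (F n))

/-- If each of the events `E s` has probability at least `c`, then at some point the set of
indices of the events that occur has upper density at least `c`. -/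
lemma exists_le_upperDensity {Ω : Type*} [MeasurableSpace Ω] (μ : Measure Ω)
    [IsProbabilityMeasure μ] (E : S → Set Ω) (hE : ∀ s, MeasurableSet (E s)) {c : ℝ}
    (hc : ∀ s, ENNReal.ofReal c ≤ μ (E s)) (F : ℕ → Finset S) (hF : ∀ n, (F n).Nonempty) :
    ∃ ω, c ≤ upperDensity F {s | ω ∈ E s} := by
  classical
  let φ : ℕ → Ω → ℝ≥0∞ := fun n ω =>
    (∑ s ∈ F n, (E s).indicator (fun _ => (1 : ℝ≥0∞)) ω) / (#(F n) : ℝ≥0∞)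
  have hφ : ∀ n ω, φ n ω =
      ENNReal.ofReal ((({s | ω ∈ E s} ∩ (F n : Set S)).ncard : ℝ) / (#(F n) : ℝ)) := by
    intro n ω
    rw [ENNReal.ofReal_div_of_pos (by exact_mod_cast (hF n).card_pos), ENNReal.ofReal_natCast,
      ENNReal.ofReal_natCast, ncard_inter_eq_card_filter]
    simp [φ, Set.indicator_apply]
  have hφm : ∀ n, Measurable (φ n) := fun n =>
    (Finset.measurable_sum _ fun s _ => measurable_const.indicator (hE s)).div_const _
  have hφ1 : ∀ n ω, φ n ω ≤ 1 := fun n ω => by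
    rw [hφ, ENNReal.ofReal_le_one]
    exact ncard_inter_div_card_le_one _ _
  have hint : ∀ n, ENNReal.ofReal c ≤ ∫⁻ ω, φ n ω ∂μ := by
    intro n
    have h0 : (#(F n) : ℝ≥0∞) ≠ 0 := by exact_mod_cast (hF n).card_pos.ne'
    simp only [φ, div_eq_mul_inv]
    rw [lintegral_mul_const' _ _ (ENNReal.inv_ne_top.2 h0),
      lintegral_finsetSum _ fun s _ => measurable_const.indicator (hE s), ← div_eq_mul_inv,
      ENNReal.le_div_iff_mul_le (Or.inl h0) (Or.inl (ENNReal.natCast_ne_top _))]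
    calc ENNReal.ofReal c * (#(F n) : ℝ≥0∞) = ∑ s ∈ F n, ENNReal.ofReal c := by
          rw [Finset.sum_const, nsmul_eq_mul, mul_comm]
      _ ≤ _ := Finset.sum_le_sum fun s _ => by
          rw [lintegral_indicator_const (hE s), one_mul]
          exact hc s
  -- Reverse Fatou, with the constant 1 as dominating function.
  have hlim : ENNReal.ofReal c ≤ ∫⁻ ω, limsup (fun n => φ n ω) atTop ∂μ := by
    refine le_trans ?_ (limsup_lintegral_le (fun _ => 1) hφm
      (fun n => Eventually.of_forall (hφ1 n)) (by simp))
    exact le_limsup_of_frequently_le (Frequently.of_forall hint)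
  have hfin : ∫⁻ ω, limsup (fun n => φ n ω) atTop ∂μ ≠ ∞ := by
    refine ne_top_of_le_ne_top (b := ∫⁻ _, 1 ∂μ) (by simp) (lintegral_mono fun ω => ?_)
    exact limsup_le_of_le (h := Eventually.of_forall fun n => hφ1 n ω)
  obtain ⟨ω, hω⟩ := exists_lintegral_le hfin
  refine ⟨ω, le_of_forall_lt fun d hd => ?_⟩
  by_contra! hlt
  obtain ⟨e, hde, hec⟩ := exists_between hd
  have hev := eventually_lt_of_limsup_lt (hlt.trans_lt hde) (isBoundedUnder_density F _)
  have he0 : 0 ≤ e := by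
    obtain ⟨n, hn⟩ := hev.exists
    exact (ncard_inter_div_card_nonneg _ _).trans hn.le
  have : limsup (fun n => φ n ω) atTop ≤ ENNReal.ofReal e := by
    refine limsup_le_of_le (h := hev.mono fun n hn => ?_)
    rw [hφ]
    exact ENNReal.ofReal_le_ofReal hn.le
  have hce := (hlim.trans hω).trans this
  rw [ENNReal.ofReal_le_ofReal_iff he0] at hce
  exact hec.not_ge hce

/-- The points of `S → Bool`, regarded as subsets of `S`, that contain no member of `𝒜`. -/
def avoiders (𝒜 : Set (Finset S)) : Set (S → Bool) := {x | ∀ A ∈ 𝒜, ∃ a ∈ A, x a = false}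

lemma isClosed_avoiders (𝒜 : Set (Finset S)) : IsClosed (avoiders 𝒜) := by
  have : avoiders 𝒜 = ⋂ A ∈ 𝒜, ⋃ a ∈ A, (fun x : S → Bool => x a) ⁻¹' {false} := by
    ext x
    simp [avoiders]
  rw [this]
  exact isClosed_biInter fun A _ => A.finite_toSet.isClosed_biUnion fun a _ =>
    (isClosed_discrete _).preimage (continuous_apply a)

end Density

variable {S : Type*} [Semigroup S] [DecidableEq S]

lemma bddAbove_upperDensity (B : Set S) :
    BddAbove {d : ℝ | ∃ F : ℕ → Finset S, IsLeftFolner F ∧ d = upperDensity F B} :=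
  ⟨1, by rintro _ ⟨F, -, rfl⟩; exact upperDensity_le_one F B⟩

lemma IsLeftFolner.upperDensity_le {F : ℕ → Finset S} (hF : IsLeftFolner F) (B : Set S) :
    upperDensity F B ≤ upperBanachDensity B :=
  le_csSup (bddAbove_upperDensity B) ⟨F, hF, rfl⟩

lemma IsLeftFolner.eventually_lt {F : ℕ → Finset S} (hF : IsLeftFolner F) (s : S) {ε : ℝ}
    (hε : 0 < ε) :
    ∀ᶠ n in atTop, (#(symmDiff (leftTranslate s (F n)) (F n)) : ℝ) < ε * (#(F n) : ℝ) := by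
  filter_upwards [(hF.2 s).eventually_lt_const hε] with n hn
  rwa [div_lt_iff₀ (by exact_mod_cast (hF.1 n).card_pos)] at hn

lemma IsLeftFolner.eventually_isInvariant {F : ℕ → Finset S} (hF : IsLeftFolner F)
    (K : Finset S) {ε : ℝ} (hε : 0 < ε) : ∀ᶠ n in atTop, IsInvariant K ε (F n) :=
  (Finset.eventually_all K).2 fun k _ => hF.eventually_lt k hε

lemma IsInvariant.nonempty {K F : Finset S} {ε : ℝ} (h : IsInvariant K ε F) (hK : K.Nonempty) :
    F.Nonempty := by
  obtain ⟨k, hk⟩ := hK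
  by_contra hne
  rw [Finset.not_nonempty_iff_eq_empty] at hne
  subst hne
  simpa [leftTranslate] using h k hk

/-- A point of `B ∩ F` either is `s * f` with `f ∈ F`, or lies in `F` outside `sF`. -/
lemma ncard_inter_le_card_filter_add (s : S) (B : Set S) (F : Finset S)
    [DecidablePred fun f => s * f ∈ B] :
    (B ∩ (F : Set S)).ncard ≤ #{f ∈ F | s * f ∈ B} + #(symmDiff (leftTranslate s F) F) := by
  classical
  rw [ncard_inter_eq_card_filter]
  calc #{x ∈ F | x ∈ B}
      ≤ #(({f ∈ F | s * f ∈ B}.image fun f => s * f) ∪ symmDiff (leftTranslate s F) F) := by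
        refine Finset.card_le_card fun x hx => ?_
        obtain ⟨hxF, hxB⟩ := Finset.mem_filter.1 hx
        rw [Finset.mem_union]
        by_cases hxs : x ∈ leftTranslate s F
        · obtain ⟨f, hf, rfl⟩ := Finset.mem_image.1 hxs
          exact Or.inl (Finset.mem_image_of_mem _ (Finset.mem_filter.2 ⟨hf, hxB⟩))
        · exact Or.inr (Finset.mem_symmDiff.2 (Or.inr ⟨hxF, hxs⟩))
    _ ≤ _ := (Finset.card_union_le _ _).trans (Nat.add_le_add_right Finset.card_image_le _)

/-- A dense subset of a sufficiently invariant set contains a dense part of some right translate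
of a given finite set. -/
lemma exists_lt_card_filter_mul_mem {H F : Finset S} (hH : H.Nonempty) {c d : ℝ}
    (hF : IsInvariant H (d - c) F) (B : Set S) (hB : d * (#F : ℝ) < (B ∩ (F : Set S)).ncard)
    [∀ f, DecidablePred fun h => h * f ∈ B] :
    ∃ f ∈ F, c * (#H : ℝ) < #{h ∈ H | h * f ∈ B} := by
  classical
  -- Count the pairs `(h, f)` with `h * f ∈ B` in both orders.
  by_contra! hcon
  have hswap : ∑ h ∈ H, #{f ∈ F | h * f ∈ B} = ∑ f ∈ F, #{h ∈ H | h * f ∈ B} := by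
    simp only [Finset.card_filter]
    exact Finset.sum_comm
  have hupper : ∑ f ∈ F, (#{h ∈ H | h * f ∈ B} : ℝ) ≤ ∑ f ∈ F, c * (#H : ℝ) :=
    Finset.sum_le_sum hcon
  have hlower : ∑ h ∈ H, c * (#F : ℝ) < ∑ h ∈ H, (#{f ∈ F | h * f ∈ B} : ℝ) := by
    refine Finset.sum_lt_sum_of_nonempty hH fun h hh => ?_
    have h1 : ((B ∩ (F : Set S)).ncard : ℝ) ≤
        #{f ∈ F | h * f ∈ B} + #(symmDiff (leftTranslate h F) F) := by
      exact_mod_cast ncard_inter_le_card_filter_add h B F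
    linarith [hF h hh]
  have hswap' : ∑ h ∈ H, (#{f ∈ F | h * f ∈ B} : ℝ) = ∑ f ∈ F, (#{h ∈ H | h * f ∈ B} : ℝ) := by
    exact_mod_cast hswap
  rw [Finset.sum_const, nsmul_eq_mul] at hupper hlower
  linarith

lemma exists_mem_subset_of_lt_upperBanachDensity (hS : IsLeftAmenable S) {𝒜 : Set (Finset S)}
    (h𝒜 : IsRightTranslationInvariant 𝒜) {H : Finset S} (hH : H.Nonempty) {c : ℝ}
    (h : ∀ B : Finset S, B ⊆ H → c * (#H : ℝ) < (#B : ℝ) → ∃ A ∈ 𝒜, A ⊆ B)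
    {B : Set S} (hB : c < upperBanachDensity B) : ∃ A ∈ 𝒜, (A : Set S) ⊆ B := by
  classical
  obtain ⟨F₀, hF₀⟩ := hS
  have hne : {d : ℝ | ∃ F : ℕ → Finset S, IsLeftFolner F ∧ d = upperDensity F B}.Nonempty :=
    ⟨_, F₀, hF₀, rfl⟩
  obtain ⟨_, ⟨F, hF, rfl⟩, hcF⟩ := exists_lt_of_lt_csSup hne hB
  -- The gap `d - c` is the invariance tolerance spent in the double counting.
  obtain ⟨d, hcd, hdF⟩ := exists_between hcF
  have hfreq := frequently_lt_of_lt_limsup (isCoboundedUnder_density F B) hdF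
  obtain ⟨n, hn, hinv⟩ :=
    (hfreq.and_eventually (hF.eventually_isInvariant H (sub_pos.2 hcd))).exists
  rw [lt_div_iff₀ (by exact_mod_cast (hF.1 n).card_pos)] at hn
  obtain ⟨f, -, hf⟩ := exists_lt_card_filter_mul_mem hH hinv B hn
  obtain ⟨A, hA, hAB⟩ := h _ (Finset.filter_subset _ _) hf
  refine ⟨_, h𝒜 A hA f, fun x hx => ?_⟩
  obtain ⟨a, ha, rfl⟩ := Finset.mem_image.1 (Finset.mem_coe.1 hx)
  exact (Finset.mem_filter.1 (hAB ha)).2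

lemma isLeftFolner_of_isInvariant {F K : ℕ → Finset S} {ε : ℕ → ℝ} (hne : ∀ n, (F n).Nonempty)
    (hK : ∀ s, ∀ᶠ n in atTop, s ∈ K n) (hε : Tendsto ε atTop (𝓝 0))
    (hF : ∀ n, IsInvariant (K n) (ε n) (F n)) : IsLeftFolner F := by
  refine ⟨hne, fun s => squeeze_zero' (Eventually.of_forall fun n => by positivity) ?_ hε⟩
  filter_upwards [hK s] with n hn
  rw [div_le_iff₀ (by exact_mod_cast (hne n).card_pos)]
  exact (hF n s hn).le

/-- A correspondence principle: dense subsets of the members of a left Følner sequence that contain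
no member of `𝒜` give rise to a subset of the semigroup with the same properties. -/
lemma exists_le_upperDensity_of_forall_not_subset [Countable S] {𝒜 : Set (Finset S)}
    (h𝒜 : IsRightTranslationInvariant 𝒜) {F B : ℕ → Finset S} (hF : IsLeftFolner F)
    (hBF : ∀ n, B n ⊆ F n) {δ : ℝ} (hB : ∀ n, δ * (#(F n) : ℝ) ≤ #(B n))
    (hA : ∀ n, ∀ A ∈ 𝒜, ¬ A ⊆ B n) :
    ∃ C : Set S, δ ≤ upperDensity F C ∧ ∀ A ∈ 𝒜, ¬ (A : Set S) ⊆ C := by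
  classical
  let X : Type _ := avoiders 𝒜
  have : CompactSpace X := isCompact_iff_compactSpace.1 (isClosed_avoiders 𝒜).isCompact
  let g : ℕ → S → X := fun n f => ⟨fun s => decide (s * f ∈ B n), fun A hA' => by
    by_contra! hcon
    refine hA n _ (h𝒜 A hA' f) fun x hx => ?_
    obtain ⟨a, ha, rfl⟩ := Finset.mem_image.1 hx
    simpa using hcon a ha⟩
  let E : S → Set X := fun s => {x | x.1 s = true}
  have hE : ∀ s, IsClopen (E s) := fun s =>
    (isClopen_discrete {true}).preimage ((continuous_apply s).comp continuous_subtype_val)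
  let ν : ℕ → ProbabilityMeasure X := fun n =>
    ⟨((PMF.uniformOfFinset (F n) (hF.1 n)).map (g n)).toMeasure, inferInstance⟩
  have hν : ∀ n s, (ν n : Measure X) (E s) = (#{f ∈ F n | s * f ∈ B n} : ℝ≥0∞) / #(F n) := by
    intro n s
    let : MeasurableSpace S := ⊤
    change ((PMF.uniformOfFinset (F n) (hF.1 n)).map (g n)).toMeasure (E s) = _
    rw [PMF.toMeasure_map_apply _ _ _ (measurable_from_top) (hE s).isOpen.measurableSet,
      PMF.toMeasure_uniformOfFinset_apply _ _ MeasurableSpace.measurableSet_top]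
    simp [E, g]
  have hlow : ∀ s, ∀ η > 0, ∀ᶠ n in atTop, ENNReal.ofReal (δ - η) ≤ (ν n : Measure X) (E s) := by
    intro s η hη
    filter_upwards [hF.eventually_lt s hη] with n hn
    have hpos : (0 : ℝ) < #(F n) := by exact_mod_cast (hF.1 n).card_pos
    rw [hν, ← ENNReal.ofReal_natCast, ← ENNReal.ofReal_natCast,
      ← ENNReal.ofReal_div_of_pos hpos]
    refine ENNReal.ofReal_le_ofReal ?_
    rw [le_div_iff₀ hpos]
    have h1 : ((((B n : Set S) ∩ (F n : Set S)).ncard : ℕ) : ℝ) ≤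
        #{f ∈ F n | s * f ∈ B n} + #(symmDiff (leftTranslate s (F n)) (F n)) := by
      exact_mod_cast ncard_inter_le_card_filter_add s (B n : Set S) (F n)
    rw [Set.inter_eq_left.2 (by exact_mod_cast hBF n), Set.ncard_coe_finset] at h1
    linarith [hB n]
  -- Compactness of the space of probability measures gives a limit along `u`. Each `E s` is clopen,
  -- so its measure passes to the limit.
  let u : Ultrafilter ℕ := hyperfilter ℕ
  obtain ⟨μ, -, hμ⟩ := isCompact_univ.ultrafilter_le_nhds (u.map ν) (by simp)
  have hμ' : Tendsto ν u (𝓝 μ) := hμ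
  have hu : (u : Filter ℕ) ≤ atTop := by
    rw [← Nat.cofinite_eq_atTop]
    exact hyperfilter_le_cofinite
  have hμE : ∀ s, ENNReal.ofReal δ ≤ (μ : Measure X) (E s) := by
    intro s
    have ht := ProbabilityMeasure.tendsto_measure_of_null_frontier_of_tendsto' hμ'
      (E := E s) (by simp [(hE s).frontier_eq])
    have hη : ∀ η > 0, ENNReal.ofReal (δ - η) ≤ (μ : Measure X) (E s) := fun η hη =>
      ge_of_tendsto ht ((hlow s η hη).filter_mono hu)
    have hcont : Tendsto (fun η : ℝ => ENNReal.ofReal (δ - η)) (𝓝[>] 0) (𝓝 (ENNReal.ofReal δ)) := by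
      have : Continuous fun η : ℝ => ENNReal.ofReal (δ - η) :=
        ENNReal.continuous_ofReal.comp (by fun_prop)
      simpa using (this.tendsto 0).mono_left nhdsWithin_le_nhds
    exact le_of_tendsto hcont (eventually_mem_nhdsWithin.mono hη)
  obtain ⟨x, hx⟩ := exists_le_upperDensity (μ : Measure X) E (fun s => (hE s).isOpen.measurableSet) hμE
    F hF.1
  refine ⟨_, hx, fun A hA' hsub => ?_⟩
  obtain ⟨a, ha, hxa⟩ := x.2 A hA'
  have : x.1 a = true := hsub (Finset.mem_coe.2 ha)
  simp [hxa] at this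

lemma exists_isInvariant_forall_exists_subset [Countable S] [Nonempty S] {𝒜 : Set (Finset S)}
    (h𝒜 : IsRightTranslationInvariant 𝒜) {δ : ℝ}
    (h : ∀ B : Set S, δ ≤ upperBanachDensity B → ∃ A ∈ 𝒜, (A : Set S) ⊆ B) :
    ∃ K : Finset S, ∃ ε : ℝ, 0 < ε ∧ ∀ F : Finset S, IsInvariant K ε F →
      ∀ B : Finset S, B ⊆ F → δ * (#F : ℝ) ≤ (#B : ℝ) → ∃ A ∈ 𝒜, A ⊆ B := by
  by_contra! hcon
  obtain ⟨e, he⟩ := exists_surjective_nat S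
  choose F hF B hBF hB hA using fun n : ℕ =>
    hcon ((Finset.range (n + 1)).image e) (1 / ((n : ℝ) + 1)) (by positivity)
  -- The range `n + 1` keeps every `K` nonempty; the empty set is invariant under an empty `K`.
  have hne : ∀ n, (F n).Nonempty := fun n =>
    (hF n).nonempty (Finset.nonempty_range_add_one.image e)
  have hFol : IsLeftFolner F := by
    refine isLeftFolner_of_isInvariant hne (fun s => ?_) tendsto_one_div_add_atTop_nhds_zero_nat hF
    obtain ⟨m, rfl⟩ := he s
    filter_upwards [eventually_ge_atTop m] with n hn
    exact Finset.mem_image_of_mem e (Finset.mem_range.2 (Nat.lt_succ_of_le hn))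
  obtain ⟨C, hC, hAC⟩ := exists_le_upperDensity_of_forall_not_subset h𝒜 hFol hBF hB hA
  obtain ⟨A, hA', hsub⟩ := h C (hC.trans (hFol.upperDensity_le C))
  exact hAC A hA' hsub

/-- A lower bound for cardinalities by a positive real can be relaxed a little. -/
lemma exists_pos_forall_le_of_sub_lt {N : ℕ} (hN : 0 < N) (δ : ℝ) :
    ∃ ε : ℝ, 0 < ε ∧ ∀ m : ℕ, (δ - ε) * (N : ℝ) < m → δ * (N : ℝ) ≤ m := by
  have hN' : (0 : ℝ) < N := by exact_mod_cast hN
  -- Chosen so that `(δ - ε) * N = ⌈δ * N⌉ - 1`.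
  refine ⟨(δ * N - (⌈δ * N⌉ - 1)) / N, div_pos ?_ hN', fun m hm => ?_⟩
  · linarith [Int.ceil_lt_add_one (δ * (N : ℝ))]
  · rw [sub_mul, div_mul_cancel₀ _ hN'.ne'] at hm
    have h1 : ((⌈δ * N⌉ - 1 : ℤ) : ℝ) < ((m : ℤ) : ℝ) := by push_cast; linarith
    have h2 : ⌈δ * N⌉ ≤ (m : ℤ) := by
      have := Int.cast_lt.1 h1
      omega
    exact_mod_cast Int.ceil_le.1 h2

end DensityRamsey

theorem mainTheorem4 {S : Type*} [Semigroup S] [IsCancelMul S] [Countable S] [Infinite S]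
    [DecidableEq S] (hS : DensityRamsey.IsLeftAmenable S)
    (δ : ℝ) (hδ : 0 < δ) (hδ' : δ ≤ 1)
    (𝒜 : Set (Finset S)) (h𝒜 : DensityRamsey.IsRightTranslationInvariant 𝒜) :
    List.TFAE [
      ∀ B : Set S, δ ≤ DensityRamsey.upperBanachDensity B →
        ∃ A ∈ 𝒜, (A : Set S) ⊆ B,
      ∃ K : Finset S, ∃ ε : ℝ, 0 < ε ∧
        ∀ F : Finset S, DensityRamsey.IsInvariant K ε F →
          ∀ B : Finset S, B ⊆ F → δ * (F.card : ℝ) ≤ (B.card : ℝ) → ∃ A ∈ 𝒜, A ⊆ B,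
      ∃ H : Finset S,
        ∀ B : Finset S, B ⊆ H → δ * (H.card : ℝ) ≤ (B.card : ℝ) → ∃ A ∈ 𝒜, A ⊆ B,
      ∃ H : Finset S, H.Nonempty ∧ ∃ ε : ℝ, 0 < ε ∧
        ∀ B : Finset S, B ⊆ H → (δ - ε) * (H.card : ℝ) < (B.card : ℝ) → ∃ A ∈ 𝒜, A ⊆ B,
      ∃ ε : ℝ, 0 < ε ∧
        ∀ B : Set S, δ - ε < DensityRamsey.upperBanachDensity B →
          ∃ A ∈ 𝒜, (A : Set S) ⊆ B ] := by
  tfae_have 1 → 2 := DensityRamsey.exists_isInvariant_forall_exists_subset h𝒜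
  tfae_have 2 → 3 := by
    rintro ⟨K, ε, hε, h⟩
    obtain ⟨F, hF⟩ := hS
    obtain ⟨n, hn⟩ := (hF.eventually_isInvariant K hε).exists
    exact ⟨F n, h (F n) hn⟩
  tfae_have 3 → 4 := by
    rintro ⟨H, h⟩
    rcases H.eq_empty_or_nonempty with rfl | hH
    -- An empty `H` forces `∅ ∈ 𝒜`, so any nonempty set serves.
    · obtain ⟨A, hA, hA'⟩ := h ∅ subset_rfl (by simp)
      obtain ⟨s⟩ := ‹Infinite S›.nonempty
      exact ⟨{s}, Finset.singleton_nonempty s, 1, one_pos, fun B _ _ =>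
        ⟨A, hA, hA'.trans (Finset.empty_subset B)⟩⟩
    · obtain ⟨ε, hε, hεH⟩ := DensityRamsey.exists_pos_forall_le_of_sub_lt hH.card_pos δ
      exact ⟨H, hH, ε, hε, fun B hB hlt => h B hB (hεH _ hlt)⟩
  tfae_have 4 → 5 := by
    rintro ⟨H, hH, ε, hε, h⟩
    exact ⟨ε, hε, fun B hB =>
      DensityRamsey.exists_mem_subset_of_lt_upperBanachDensity hS h𝒜 hH h hB⟩
  tfae_have 5 → 1 := by
    rintro ⟨ε, hε, h⟩ B hB
    exact h B (by linarith)
  tfae_finish
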